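/- **Setting.** For a finite labelled sample $Z=((y_1,x_1),\dots,(y_N,x_N))$ in $\{0,1\}\times\mathcal X$ and $f:\mathcal X\to\{0,1\}$ let $\widehat R(f,Z)=\frac1N\sum_{i}I(y_i\ne f(x_i))$. Let $\mathcal F$ be a class of functions $\mathcal X\to\{0,1\}$ of finite VC dimension $h^*$, and let $M$ be a real number with $h^*\le M$. For an integer $n\ge 1$ and $h\ge 0$ put, with $a=0.16$, $a'=1.2$, $a''=0.14927$, $$\Phi_h(n)=\begin{cases}1 & n<h/2,\\ a\,\dfrac{\log\frac{2n}{h}+1}{\frac nh-a''}\left(\sqrt{1+\dfrac{a'\left(\frac nh-a''\right)}{\log\frac{2n}{h}+1}}+1\right)&\text{otherwise,}\end{cases}\qquad \Phi_0(n)=\lim_{h\downarrow0}\Phi_h(n)=0 .$$ **Simulation (Vapnik–Levin).** Let $k,m\ge1$ and let $n_1,\dots,n_k\ge1$ be integers (the design points). For each $\ell\le k$ and each $i\le m$ draw a data set of $2n_\ell$ points of $\{0,1\}\times\mathcal X$, all points being independent with the same law $\nu$; split it into halves $W,W'$ of size $n_\ell$; let $\hat f\in\mathcal F$ minimize the empirical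 risk over $\mathcal F$ on the union of $W$ and of $W'$ with flipped labels; put $\widehat\xi_i(n_\ell)=|\widehat R(\hat f,W)-\widehat R(\hat f,W')|$ (with the original labels in both terms) and $\widehat\xi(n_\ell)=\frac1m\sum_{i=1}^m\widehat\xi_i(n_\ell)$. Assume the regression model $\widehat\xi(n_\ell)=\Phi_{h^*}(n_\ell)+\epsilon(n_\ell)$ with $\mathbb E\,\epsilon(n_\ell)=0$ for every $\ell$. Let $\hat h$ be, almost surely, a minimizer over $h\in[0,M]$ of $\|\widehat\xi-\Phi_h\|_k=\big(\frac1k\sum_{\ell=1}^k(\widehat\xi(n_\ell)-\Phi_h(n_\ell))^2\big)^{1/2}$. **Constants.** Let $c(n_\ell,M)\ge0$ satisfy $c(n_\ell,M)|h-h'|\le|\Phi_h(n_\ell)-\Phi_{h'}(n_\ell)|$ for all $h,h'\in[0,M)$, and let $h_0>0$ and $L(n_\ell)$ satisfy $|\Phi_h(n_\ell)-\Phi_{h'}(n_\ell)|\le L(n_\ell)|h-h'|$ for all $h,h'\in[h_0,\min\{M,2n_\ell\}]$. Put $$c'=\frac1k\sum_{\ell=1}^kL^2(n_\ell),\quad c_1=\left(c'+\tfrac14\right)\sqrt{\log(4c'+1)}-\frac{\sqrt\pi}{8}\,\mathrm{erfi}\!\left(\sqrt{4c'+1}\right),\quad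 c_2=\frac1k\sum_{\ell=1}^kc^2(n_\ell,M),\quad c_3=2304,$$ where $\mathrm{erfi}(x)=\frac{2}{\sqrt\pi}\int_0^xe^{t^2}\,dt$. **Theorem.** If $\delta>\frac{4}{\sqrt{2mk}}\max\{24c_1,29\}$, then $$P\left(|\hat h-h^*|>\delta\right)\le13\exp\left\{-\frac{mk\,c_2\,\delta^2}{16\,c_3}\right\}.$$ -/

import Mathlib

namespace VCEst

/-- A family `𝒞` of subsets of `U` shatters the finite set `S` if every subset of `S` is of the
form `S ∩ C` with `C ∈ 𝒞`. -/
def Shatters {U : Type*} (𝒞 : Set (Set U)) (S : Finset U) : Prop :=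
  ∀ S' : Set U, S' ⊆ (S : Set U) → ∃ C ∈ 𝒞, S' = (S : Set U) ∩ C

/-- The Vapnik–Chervonenkis dimension of a family of sets. -/
noncomputable def vcDimSets {U : Type*} (𝒞 : Set (Set U)) : ℕ∞ :=
  ⨆ S : {S : Finset U // Shatters 𝒞 S}, (S.1.card : ℕ∞)

/-- The Vapnik–Chervonenkis dimension of a class of classifiers `X → {0,1}`. -/
noncomputable def vcDim {X : Type*} (F : Set (X → Bool)) : ℕ∞ :=
  vcDimSets {C : Set X | ∃ f ∈ F, C = {x | f x = true}}

/-- The empirical risk of the classifier `f` on the labelled data set `Z` (pairs `(y, x)`). -/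
noncomputable def empRisk {X ι : Type*} [Fintype ι] (f : X → Bool) (Z : ι → Bool × X) : ℝ :=
  (∑ i, if (Z i).1 ≠ f (Z i).2 then (1 : ℝ) else 0) / (Fintype.card ι : ℝ)

/-- `fhat` returns on every data set a minimizer over `F` of the empirical risk. Data sets of size
`2 n` are indexed by `Fin n ⊕ Fin n`, which records their splitting into two halves. -/
def IsERM {X : Type*} (F : Set (X → Bool))
    (fhat : (n : ℕ) → (Fin n ⊕ Fin n → Bool × X) → X → Bool) : Prop :=
  ∀ (n : ℕ) (D : Fin n ⊕ Fin n → Bool × X),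
    fhat n D ∈ F ∧ ∀ f ∈ F, empRisk (fhat n D) D ≤ empRisk f D

/-- The first half `W` unchanged, merged with the second half `W'` with flipped labels. -/
def flipSecond {X : Type*} {n : ℕ} (D : Fin n ⊕ Fin n → Bool × X) : Fin n ⊕ Fin n → Bool × X :=
  Sum.elim (fun j => D (Sum.inl j)) (fun j => (!(D (Sum.inr j)).1, (D (Sum.inr j)).2))

/-- One replication of the simulation: train on the merged set (`W` with its labels, `W'` with
flipped labels) and return the absolute difference of the errors of the trained classifier on `W`
and on `W'`, both with their original labels. -/
noncomputable def deviation {X : Type*} (fhat : (n : ℕ) → (Fin n ⊕ Fin n → Bool × X) → X → Bool)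
    (n : ℕ) (D : Fin n ⊕ Fin n → Bool × X) : ℝ :=
  |empRisk (fhat n (flipSecond D)) (fun j => D (Sum.inl j))
    - empRisk (fhat n (flipSecond D)) (fun j => D (Sum.inr j))|

/-- The average of the deviations of `m` replications at sample size `n`. -/
noncomputable def xiHat {X : Type*} (fhat : (n : ℕ) → (Fin n ⊕ Fin n → Bool × X) → X → Bool)
    (n m : ℕ) (D : Fin m → Fin n ⊕ Fin n → Bool × X) : ℝ :=
  (1 / (m : ℝ)) * ∑ i, deviation fhat n (D i)

/-- The function `Φ_h(n)`, with `a = 0.16`, `a' = 1.2`, `a'' = 0.14927`; its value at `h = 0` is the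
limit `0` as `h` decreases to `0` (for `n ≥ 1`). -/
noncomputable def Phi (h : ℝ) (n : ℕ) : ℝ :=
  if h = 0 then 0
  else if (n : ℝ) < h / 2 then 1
  else 0.16 * ((Real.log (2 * n / h) + 1) / (n / h - 0.14927)) *
    (√(1 + 1.2 * (n / h - 0.14927) / (Real.log (2 * n / h) + 1)) + 1)

/-- The norm `‖g‖_k` of the vector of the values of `g` at the `k` design points. -/
noncomputable def designNorm {k : ℕ} (g : Fin k → ℝ) : ℝ :=
  √((1 / (k : ℝ)) * ∑ l, g l ^ 2)

/-- `h` is a least-squares fit over `[0, M]` of `Φ_h` to the observations `ξ`. -/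
def IsLeastSquaresFit {k : ℕ} (n : Fin k → ℕ) (M : ℝ) (ξ : Fin k → ℝ) (h : ℝ) : Prop :=
  h ∈ Set.Icc 0 M ∧ IsMinOn (fun h' => designNorm fun l => ξ l - Phi h' (n l)) (Set.Icc 0 M) h

/-- The imaginary error function. -/
noncomputable def erfi (x : ℝ) : ℝ :=
  2 / √Real.pi * ∫ t in (0 : ℝ)..x, Real.exp (t ^ 2)

/-- The mean of the squares of `u` over the design points. -/
noncomputable def meanSq {k : ℕ} (n : Fin k → ℕ) (u : ℕ → ℝ) : ℝ :=
  (1 / (k : ℝ)) * ∑ l, u (n l) ^ 2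

/-- The constant `c₁` as a function of `c'`. -/
noncomputable def c1 (c' : ℝ) : ℝ :=
  (c' + 1 / 4) * √(Real.log (4 * c' + 1)) - √Real.pi / 8 * erfi (√(4 * c' + 1))

/-- The constant `c₃`. -/
def c3 : ℝ := 2304

end VCEst

open MeasureTheory ProbabilityTheory VCEst

/-! Comparing the fit with `h*` gives the basic inequality of least squares
(`half_sum_sq_le_of_fit`): with `Δ_h = Φ_h - Φ_{h*}` and noise `ε`, half of `|Δ_ĥ|²` is at most `⟨ε,
Δ_ĥ⟩`. If `|ĥ - h*| > δ`, the lower constants `c` force `|Δ_ĥ|² ≥ R = k c₂ δ²`. It remains to bound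
the probability that `⟨ε, Δ_h⟩ ≥ |Δ_h|² / 2` for some `h` with `|Δ_h|² ≥ R`.

For one fixed vector this is Hoeffding's inequality (`hoeffding_linear_combination`). Uniformity in
`h` comes from monotonicity: `Φ_h(n)` increases with `h` for every `n` (`Phi_monotoneOn`), so on
each side of `h*` the vectors `Δ_h` form a coordinatewise chain of constant sign. There the squared
distance is at most the difference of squared norms (`sum_sq_sub_Phi_le`), so the index set is as
small as a real interval: a shell `T ≤ |v|² < 2T` splits into `2 ^ j` cells of squared diameter at
most `T / 2 ^ j`. Chaining over these nets (`measure_shell_le`) and summing over the shells `T = 2 ^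
p R` (`measure_exists_half_sq_le`) costs only constant factors. Where `mR` is too small for
chaining, the claimed bound already exceeds `1`. -/

namespace VCEst

/-! ### Monotonicity of `Φ` -/

/-- `Φ` as an increasing function of the ratio `A = (log (2 τ) + 1) / (τ - a'')`, `τ = n / h`. -/
lemma Phi_eq_of_le {h : ℝ} {n : ℕ} (hh : 0 < h) (hn : h ≤ 2 * n) :
    Phi h n = 0.16 * (√(((Real.log (2 * (n / h)) + 1) / (n / h - 0.14927)) ^ 2
        + 1.2 * ((Real.log (2 * (n / h)) + 1) / (n / h - 0.14927)))
      + (Real.log (2 * (n / h)) + 1) / (n / h - 0.14927)) := by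
  have hτ : (1 : ℝ) / 2 ≤ n / h := by rw [le_div_iff₀ hh]; linarith
  have hlog : 0 ≤ Real.log (2 * (n / h)) := Real.log_nonneg (by linarith)
  rw [Phi, if_neg hh.ne', if_neg (by linarith), mul_div_assoc]
  set τ : ℝ := n / h
  have h1 : 0 < τ - 0.14927 := by norm_num at hτ ⊢; linarith
  have h2 : 0 < Real.log (2 * τ) + 1 := by linarith
  set A := (Real.log (2 * τ) + 1) / (τ - 0.14927) with hA
  have hA0 : 0 < A := by positivity
  have h3 : 1 + 1.2 * (τ - 0.14927) / (Real.log (2 * τ) + 1) = 1 + 1.2 / A := by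
    rw [hA]; field_simp
  rw [h3]
  have h4 : A ^ 2 + 1.2 * A = A ^ 2 * (1 + 1.2 / A) := by field_simp
  rw [h4, Real.sqrt_mul (by positivity), Real.sqrt_sq hA0.le]
  ring

/-- The tangent to `log` at `s` gives `log (2t) ≤ log (2s) + t/s - 1`; after clearing denominators,
`log (2s) ≥ 0` and `t/s ≥ 1` suffice. -/
lemma ratio_antitone {s t : ℝ} (hs : 1 / 2 ≤ s) (hst : s ≤ t) :
    (Real.log (2 * t) + 1) / (t - 0.14927) ≤ (Real.log (2 * s) + 1) / (s - 0.14927) := by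
  have hs0 : 0 < s := by linarith
  have ht0 : 0 < t := by linarith
  have h1 : 0 < s - 0.14927 := by norm_num at hs ⊢; linarith
  have hls : 0 ≤ Real.log (2 * s) := Real.log_nonneg (by linarith)
  have hlt : Real.log (2 * t) ≤ Real.log (2 * s) + (t / s - 1) := by
    have := Real.log_le_sub_one_of_pos (div_pos ht0 hs0)
    rw [Real.log_div ht0.ne' hs0.ne'] at this
    rw [Real.log_mul two_ne_zero ht0.ne', Real.log_mul two_ne_zero hs0.ne']
    linarith
  rw [div_le_div_iff₀ (by linarith) h1]
  have hts : 1 ≤ t / s := by rwa [one_le_div hs0]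
  have e : t / s * s = t := by field_simp
  have h2 := mul_le_mul_of_nonneg_right hlt h1.le
  nlinarith [mul_nonneg hls (sub_nonneg.2 hst)]

lemma Phi_mono_of_le {h h' : ℝ} {n : ℕ} (hh : 0 < h) (hle : h ≤ h') (hn : h' ≤ 2 * n) :
    Phi h n ≤ Phi h' n := by
  have hh' : 0 < h' := hh.trans_le hle
  rw [Phi_eq_of_le hh (hle.trans hn), Phi_eq_of_le hh' hn]
  have hτ : (1 : ℝ) / 2 ≤ n / h' := by rw [le_div_iff₀ hh']; linarith
  have hA := ratio_antitone hτ (div_le_div_of_nonneg_left (Nat.cast_nonneg n) hh hle)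
  have hτ' : (1 : ℝ) / 2 ≤ n / h := by rw [le_div_iff₀ hh]; linarith
  have hA0 : 0 ≤ (Real.log (2 * (n / h)) + 1) / (n / h - 0.14927) := by
    have := Real.log_nonneg (x := 2 * (n / h)) (by linarith)
    refine div_nonneg (by linarith) ?_
    norm_num at hτ' ⊢; linarith
  gcongr

/-- This makes the jump of `Φ` to the value `1` just beyond `h = 2n` an upward one, so monotonicity
survives it. -/
lemma Phi_two_mul_le_one {n : ℕ} (hn : 0 < n) : Phi (2 * n) n ≤ 1 := by
  have hn' : (0 : ℝ) < n := by exact_mod_cast hn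
  rw [Phi, if_neg (by positivity), if_neg (by linarith)]
  have e1 : (2 * n / (2 * n) : ℝ) = 1 := by field_simp
  have e2 : (n / (2 * n) : ℝ) = 1 / 2 := by field_simp
  rw [e1, e2, Real.log_one]
  -- The largest admissible bound is `0.35073 / 0.16 - 1 = 1.1920625`.
  have : √(1 + 1.2 * (1 / 2 - 0.14927) / (0 + 1)) ≤ 1.19206 := by
    rw [Real.sqrt_le_left (by norm_num)]; norm_num
  norm_num at this ⊢
  linarith

lemma Phi_nonneg {h : ℝ} (hh : 0 ≤ h) (n : ℕ) : 0 ≤ Phi h n := by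
  rcases hh.eq_or_lt with rfl | hh
  · simp [Phi]
  by_cases hn : h ≤ 2 * n
  · rw [Phi_eq_of_le hh hn]
    have hτ : (1 : ℝ) / 2 ≤ n / h := by rw [le_div_iff₀ hh]; linarith
    have hA0 : 0 ≤ (Real.log (2 * (n / h)) + 1) / (n / h - 0.14927) := by
      have := Real.log_nonneg (x := 2 * (n / h)) (by linarith)
      refine div_nonneg (by linarith) ?_
      norm_num at hτ ⊢; linarith
    positivity
  · rw [Phi, if_neg hh.ne', if_pos (by linarith)]
    exact zero_le_one

lemma Phi_monotoneOn {n : ℕ} (hn : 0 < n) : MonotoneOn (fun h => Phi h n) (Set.Ici 0) := by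
  intro h hh h' hh' hle
  simp only [Set.mem_Ici] at hh hh'
  change Phi h n ≤ Phi h' n
  rcases hh.eq_or_lt with rfl | hh
  · simpa [Phi] using Phi_nonneg hh' n
  by_cases h1 : h' ≤ 2 * n
  · exact Phi_mono_of_le hh hle h1
  have e : Phi h' n = 1 := by
    rw [Phi, if_neg (hh.trans_le hle).ne', if_pos (by linarith)]
  rw [e]
  by_cases h2 : h ≤ 2 * n
  · exact (Phi_mono_of_le hh h2 le_rfl).trans (Phi_two_mul_le_one hn)
  · rw [Phi, if_neg hh.ne', if_pos (by linarith)]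

/-- The lower Lipschitz-like bound on `[0, M)` extends to `[0, M]`, by monotonicity. -/
lemma lower_bound_Icc {n : ℕ} (hn : 0 < n) {M c : ℝ} (hc0 : 0 ≤ c)
    (hc : ∀ h ∈ Set.Ico 0 M, ∀ h' ∈ Set.Ico 0 M, c * |h - h'| ≤ |Phi h n - Phi h' n|)
    {h h' : ℝ} (hh : h ∈ Set.Icc 0 M) (hh' : h' ∈ Set.Icc 0 M) :
    c * |h - h'| ≤ |Phi h n - Phi h' n| := by
  wlog hlt : h' ≤ h generalizing h h'
  · rw [abs_sub_comm, abs_sub_comm (Phi h n)]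
    exact this hh' hh (le_of_not_ge hlt)
  rcases hlt.eq_or_lt with rfl | hlt
  · simp
  have hm := Phi_monotoneOn hn hh'.1 hh.1 hlt.le
  simp only at hm
  rw [abs_of_pos (sub_pos.2 hlt), abs_of_nonneg (sub_nonneg.2 hm)]
  refine le_of_forall_lt_imp_le_of_dense fun a ha => ?_
  by_contra! hcon
  rcases hc0.eq_or_lt with rfl | hcpos
  · simp only [zero_mul] at ha; linarith
  have hdiv : a / c < h - h' := by rwa [div_lt_iff₀' hcpos]
  -- A point strictly below `h`, hence below `M`, that already witnesses the increment `a`; the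
  -- maximum covers negative `a`.
  set g := max (h' + a / c) h'
  have hg1 : h' ≤ g := le_max_right _ _
  have hg2 : g < h := max_lt (by linarith) hlt
  have hg := hc g ⟨hh'.1.trans hg1, hg2.trans_le hh.2⟩ h' ⟨hh'.1, hlt.trans_le hh.2⟩
  have hm1 : Phi h' n ≤ Phi g n := Phi_monotoneOn hn hh'.1 (hh'.1.trans hg1) hg1
  have hm2 : Phi g n ≤ Phi h n := Phi_monotoneOn hn (hh'.1.trans hg1) hh.1 hg2.le
  rw [abs_of_nonneg (sub_nonneg.2 hg1), abs_of_nonneg (sub_nonneg.2 hm1)] at hg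
  have : a ≤ c * (g - h') := by
    rw [← div_le_iff₀' hcpos]; linarith [le_max_left (h' + a / c) h']
  linarith

end VCEst

namespace VCEst

/-! ### The replications are independent and sub-Gaussian -/

/-- Grouping independent random variables yields independent random vectors. -/
lemma iIndepFun_curry {Ω α 𝓧 : Type*} [MeasurableSpace Ω] [MeasurableSpace 𝓧] [Countable α]
    {κ : α → Type*} [∀ a, Countable (κ a)] {P : Measure Ω} {Y : (a : α) → κ a → Ω → 𝓧}
    (hY : ∀ a b, AEMeasurable (Y a b) P)
    (h : iIndepFun (fun p : Σ a, κ a => Y p.1 p.2) P) :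
    iIndepFun (fun a ω b => Y a b ω) P := by
  have := h.isProbabilityMeasure
  have : ∀ a b, IsProbabilityMeasure (P.map (Y a b)) :=
    fun a b => Measure.isProbabilityMeasure_map (hY a b)
  have hsub : ∀ a, iIndepFun (Y a) P := fun a =>
    h.precomp (g := fun b : κ a => (⟨a, b⟩ : Σ a, κ a)) sigma_mk_injective
  have hmY : ∀ a, AEMeasurable (fun ω b => Y a b ω) P := fun a => aemeasurable_pi_iff.2 (hY a)
  rw [iIndepFun_iff_map_fun_eq_infinitePi_map₀' hmY]
  have e : (fun ω a b => Y a b ω)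
      = (MeasurableEquiv.piCurry fun a (_ : κ a) => 𝓧) ∘ fun ω (p : Σ a, κ a) => Y p.1 p.2 ω := by
    ext; simp [Sigma.curry]
  have hmp : AEMeasurable (fun ω (p : Σ a, κ a) => Y p.1 p.2 ω) P :=
    aemeasurable_pi_iff.2 fun p => hY p.1 p.2
  have hmap := h.map_fun_eq_infinitePi_map₀ hmp
  rw [e, ← AEMeasurable.map_map_of_aemeasurable (MeasurableEquiv.measurable _).aemeasurable hmp,
    hmap,
    Measure.infinitePi_map_piCurry (fun a b => P.map (Y a b))]
  congr 1
  funext a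
  exact ((hsub a).map_fun_eq_infinitePi_map₀' (hY a)).symm

lemma empRisk_mem_Icc {X ι : Type*} [Fintype ι] (f : X → Bool) (Z : ι → Bool × X) :
    empRisk f Z ∈ Set.Icc (0 : ℝ) 1 := by
  constructor
  · exact div_nonneg (Finset.sum_nonneg fun i _ => by split_ifs <;> norm_num) (Nat.cast_nonneg _)
  · refine div_le_one_of_le₀ ?_ (Nat.cast_nonneg _)
    calc _ ≤ ∑ _i : ι, (1 : ℝ) := Finset.sum_le_sum fun i _ => by split_ifs <;> norm_num
      _ = _ := by simp

lemma deviation_mem_Icc {X : Type*} (fhat : (n : ℕ) → (Fin n ⊕ Fin n → Bool × X) → X → Bool)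
    (n : ℕ) (D : Fin n ⊕ Fin n → Bool × X) : deviation fhat n D ∈ Set.Icc (0 : ℝ) 1 := by
  have h1 := empRisk_mem_Icc (fhat n (flipSecond D)) (fun j => D (Sum.inl j))
  have h2 := empRisk_mem_Icc (fhat n (flipSecond D)) (fun j => D (Sum.inr j))
  exact ⟨abs_nonneg _, abs_le.2 ⟨by linarith [h1.1, h2.2], by linarith [h1.2, h2.1]⟩⟩

/-- Hoeffding's inequality for a linear combination of centred averages of independent variables
with values in `[0, 1]`. -/
lemma hoeffding_linear_combination {Ω : Type*} [MeasurableSpace Ω] {P : Measure Ω}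
    [IsProbabilityMeasure P] {k m : ℕ} (hm : 0 < m) {ξ : Fin k × Fin m → Ω → ℝ}
    (hξ : ∀ a, AEMeasurable (ξ a) P) (h01 : ∀ a ω, ξ a ω ∈ Set.Icc (0 : ℝ) 1)
    (hind : iIndepFun ξ P) (v : Fin k → ℝ) {D x : ℝ} (hx : 0 < x)
    (hv : ∑ l, v l ^ 2 ≤ D) :
    P {ω | x ≤ ∑ l, (1 / (m : ℝ) * ∑ i, (ξ (l, i) ω - ∫ ω', ξ (l, i) ω' ∂P)) * v l}
      ≤ ENNReal.ofReal (Real.exp (-(2 * m * x ^ 2 / D))) := by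
  have hm' : (0 : ℝ) < m := by exact_mod_cast hm
  -- The exponent below divides by `|v|²`; for `v = 0` the event is empty.
  rcases (Finset.sum_nonneg fun l (_ : l ∈ Finset.univ) => sq_nonneg (v l)).eq_or_lt with h0 | h0
  · have hv0 : ∀ l, v l = 0 := fun l => by
      have := (Finset.sum_eq_zero_iff_of_nonneg fun l _ => sq_nonneg (v l)).1 h0.symm l
        (Finset.mem_univ _)
      simpa using this
    simp [hv0, hx.not_ge]
  have hsub : ∀ a ∈ (Finset.univ : Finset (Fin k × Fin m)),
      HasSubgaussianMGF (fun ω => v a.1 / m * (ξ a ω - ∫ ω', ξ a ω' ∂P))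
        (Real.toNNReal ((v a.1 / m) ^ 2 / 4)) P := fun a _ => by
    convert (hasSubgaussianMGF_of_mem_Icc (hξ a) (ae_of_all _ (h01 a))).const_mul (v a.1 / m)
    ext
    rw [Real.coe_toNNReal _ (by positivity)]
    change _ = (v a.1 / m) ^ 2 * (‖(1 : ℝ) - 0‖ / 2) ^ 2
    norm_num
    ring
  have hind' : iIndepFun (fun (a : Fin k × Fin m) ω => v a.1 / m * (ξ a ω - ∫ ω', ξ a ω' ∂P)) P :=
    hind.comp (fun a y => v a.1 / m * (y - ∫ ω', ξ a ω' ∂P)) fun a => by fun_prop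
  have key := HasSubgaussianMGF.measure_sum_ge_le_of_iIndepFun hind' hsub hx.le
  have hset : {ω | x ≤ ∑ l, (1 / (m : ℝ) * ∑ i, (ξ (l, i) ω - ∫ ω', ξ (l, i) ω' ∂P)) * v l}
      = {ω | x ≤ ∑ a : Fin k × Fin m, v a.1 / m * (ξ a ω - ∫ ω', ξ a ω' ∂P)} := by
    ext ω
    simp only [Set.mem_ofPred_eq, Fintype.sum_prod_type, ← Finset.mul_sum]
    have : ∀ l, (1 / (m : ℝ) * ∑ i, (ξ (l, i) ω - ∫ ω', ξ (l, i) ω' ∂P)) * v l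
      = v l / m * ∑ i, (ξ (l, i) ω - ∫ ω', ξ (l, i) ω' ∂P) := fun l => by ring
    simp only [this]
  rw [hset, ← ofReal_measureReal]
  refine ENNReal.ofReal_le_ofReal (key.trans (Real.exp_le_exp.2 ?_))
  have hc : ((∑ a : Fin k × Fin m, Real.toNNReal ((v a.1 / m) ^ 2 / 4) : NNReal) : ℝ)
      = (∑ l, v l ^ 2) / (4 * m) := by
    rw [NNReal.coe_sum, Fintype.sum_prod_type, Finset.sum_div]
    refine Finset.sum_congr rfl fun l _ => ?_
    simp only [Real.coe_toNNReal _ (show 0 ≤ (v l / m) ^ 2 / 4 by positivity), Finset.sum_const,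
      Finset.card_univ, Fintype.card_fin, nsmul_eq_mul]
    field_simp
  have hc' : -x ^ 2 / (2 * ((∑ l, v l ^ 2) / (4 * m))) ≤ -(2 * m * x ^ 2 / D) := by
    have : -x ^ 2 / (2 * ((∑ l, v l ^ 2) / (4 * m))) = -(2 * m * x ^ 2 / ∑ l, v l ^ 2) := by
      field_simp; ring
    rw [this, neg_le_neg_iff]
    gcongr
  refine le_trans (le_of_eq ?_) hc'
  rw [← hc]

end VCEst

namespace VCEst

/-! ### Chaining along a monotone chain of vectors -/

lemma measure_iUnion_le_of_geometric {Ω : Type*} [MeasurableSpace Ω] {P : Measure Ω}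
    {s : ℕ → Set Ω} {C : ℝ} (hC : 0 ≤ C)
    (h : ∀ j, P (s j) ≤ ENNReal.ofReal (C * (1 / 2) ^ j)) :
    P (⋃ j, s j) ≤ ENNReal.ofReal (2 * C) := by
  refine (measure_iUnion_le s).trans ((ENNReal.tsum_le_tsum h).trans ?_)
  rw [← ENNReal.ofReal_tsum_of_nonneg (fun j => by positivity)
    (summable_geometric_two.mul_left C), tsum_mul_left, tsum_geometric_two, mul_comm]

/-- Dyadic nets of the part `T ≤ |v|² < 2 T` of a set of vectors on which the squared distance is
at most the difference of the squared norms. `cell j` records the dyadic interval of length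
`T / 2 ^ j` that contains `|v|²`, and `π j` moves `v` to a representative of its cell. -/
lemma exists_dyadic_net {κ : Type*} [Fintype κ] {V : Set (κ → ℝ)}
    (hV : ∀ u ∈ V, ∀ v ∈ V, ∑ l, (u l - v l) ^ 2 ≤ |∑ l, u l ^ 2 - ∑ l, v l ^ 2|)
    {T : ℝ} (hT : 0 < T) (hshell : ∀ v ∈ V, T ≤ ∑ l, v l ^ 2 ∧ ∑ l, v l ^ 2 < 2 * T) :
    ∃ (cell : ℕ → (κ → ℝ) → ℕ) (π : ℕ → (κ → ℝ) → κ → ℝ),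
      (∀ j, ∀ v ∈ V, cell j v < 2 ^ j) ∧
      (∀ j u v, cell j u = cell j v → π j u = π j v) ∧
      (∀ j, ∀ u ∈ V, ∀ v ∈ V, cell (j + 1) u = cell (j + 1) v → cell j u = cell j v) ∧
      (∀ j, ∀ v ∈ V, π j v ∈ V) ∧
      (∀ j, ∀ v ∈ V, ∑ l, (v l - π j v l) ^ 2 ≤ T / 2 ^ j) ∧
      (∀ j, ∀ v ∈ V, ∑ l, (π (j + 1) v l - π j v l) ^ 2 ≤ T / 2 ^ j) := by
  classical
  let x : (κ → ℝ) → ℝ := fun v => (∑ l, v l ^ 2) / T - 1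
  have hx : ∀ v ∈ V, 0 ≤ x v ∧ x v < 1 := fun v hv => by
    obtain ⟨h1, h2⟩ := hshell v hv
    constructor
    · rw [sub_nonneg, one_le_div hT]; exact h1
    · rw [sub_lt_iff_lt_add, div_lt_iff₀ hT]; linarith
  let cell : ℕ → (κ → ℝ) → ℕ := fun j v => ⌊x v * 2 ^ j⌋₊
  -- The default `0` is used only for cells that contain no point of `V`.
  let ρ : ℕ → ℕ → κ → ℝ := fun j i =>
    if h : ∃ u ∈ V, cell j u = i then h.choose else 0
  have hρ : ∀ j, ∀ v ∈ V, ρ j (cell j v) ∈ V ∧ cell j (ρ j (cell j v)) = cell j v := by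
    intro j v hv
    have h : ∃ u ∈ V, cell j u = cell j v := ⟨v, hv, rfl⟩
    simp only [ρ, dif_pos h]
    exact h.choose_spec
  have hcell : ∀ j, ∀ v, cell j v = cell (j + 1) v / 2 := by
    intro j v
    simp only [cell]
    rw [← Nat.floor_div_ofNat]
    congr 1
    rw [pow_succ]
    ring
  have hdist : ∀ j, ∀ u ∈ V, ∀ v ∈ V, cell j u = cell j v → ∑ l, (u l - v l) ^ 2 ≤ T / 2 ^ j := by
    intro j u hu v hv huv
    refine (hV u hu v hv).trans ?_
    have hp : (0 : ℝ) < 2 ^ j := by positivity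
    have h1 : |x u * 2 ^ j - x v * 2 ^ j| ≤ 1 := by
      have a1 := Nat.floor_le (mul_nonneg (hx u hu).1 hp.le)
      have a2 := Nat.lt_floor_add_one (x u * 2 ^ j)
      have b1 := Nat.floor_le (mul_nonneg (hx v hv).1 hp.le)
      have b2 := Nat.lt_floor_add_one (x v * 2 ^ j)
      simp only [cell] at huv
      rw [huv] at a1 a2
      rw [abs_le]; constructor <;> linarith
    have h2 : ∑ l, u l ^ 2 - ∑ l, v l ^ 2 = T / 2 ^ j * (x u * 2 ^ j - x v * 2 ^ j) := by
      simp only [x]; field_simp; ring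
    rw [h2, abs_mul, abs_of_pos (by positivity)]
    exact mul_le_of_le_one_right (by positivity) h1
  refine ⟨cell, fun j v => ρ j (cell j v), ?_, ?_, ?_, ?_, ?_, ?_⟩
  · intro j v hv
    have h := (hx v hv).2
    have hp : (0 : ℝ) < 2 ^ j := by positivity
    simp only [cell]
    rw [Nat.floor_lt (mul_nonneg (hx v hv).1 hp.le)]
    push_cast
    exact mul_lt_of_lt_one_left hp h
  · intro j u v huv
    simp only [huv]
  · intro j u _ v _ huv
    rw [hcell, hcell j v, huv]
  · exact fun j v hv => (hρ j v hv).1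
  · exact fun j v hv => hdist j v hv _ (hρ j v hv).1 (hρ j v hv).2.symm
  · intro j v hv
    -- Cells are nested, so both representatives lie in the level-`j` cell of `v`.
    refine hdist j _ (hρ (j + 1) v hv).1 _ (hρ j v hv).1 ?_
    rw [(hρ j v hv).2, hcell, (hρ (j + 1) v hv).2, ← hcell]

/-- The maximal inequality on a shell `T ≤ |v|² < 2 T`. -/
lemma measure_shell_le {Ω κ : Type*} [MeasurableSpace Ω] {P : Measure Ω} [Fintype κ]
    {ε : Ω → κ → ℝ} {N : ℝ}
    (htail : ∀ (v : κ → ℝ) (D x : ℝ), 0 < x → ∑ l, v l ^ 2 ≤ D →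
      P {ω | x ≤ ∑ l, ε ω l * v l} ≤ ENNReal.ofReal (Real.exp (-(2 * N * x ^ 2 / D))))
    {V : Set (κ → ℝ)}
    (hV : ∀ u ∈ V, ∀ v ∈ V, ∑ l, (u l - v l) ^ 2 ≤ |∑ l, u l ^ 2 - ∑ l, v l ^ 2|)
    {T : ℝ} (hT : 0 < T) (hNT : 4608 ≤ N * T)
    (hshell : ∀ v ∈ V, T ≤ ∑ l, v l ^ 2 ∧ ∑ l, v l ^ 2 < 2 * T) :
    P {ω | ∃ v ∈ V, T / 2 ≤ ∑ l, ε ω l * v l}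
      ≤ ENNReal.ofReal (5 * Real.exp (-(N * T / 288))) := by
  obtain ⟨cell, π, hlt, hπ, hnest, hmem, hfar, hlink⟩ := exists_dyadic_net hV hT hshell
  set a := N * T / 288 with ha
  have ha16 : 16 ≤ a := by rw [ha]; linarith
  -- The budget `T/2` is split as `T/4` for the coarsest net, `∑ w j = T/6` for the links and `T/12`
  -- for the remainder. The ratio `3/4` exceeds `1/√2`, so the link exponents `a (9/8) ^ j` grow.
  let w : ℕ → ℝ := fun j => 1 / 24 * (3 / 4) ^ j * T
  have hw : ∀ j, 0 < w j := fun j => by positivity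
  let B₀ : Set Ω := {ω | ∃ v ∈ V, T / 4 ≤ ∑ l, ε ω l * π 0 v l}
  let B : ℕ → Set Ω := fun j =>
    {ω | ∃ v ∈ V, w j ≤ ∑ l, ε ω l * (π (j + 1) v l - π j v l)}
  have hcover : {ω | ∃ v ∈ V, T / 2 ≤ ∑ l, ε ω l * v l} ⊆ B₀ ∪ ⋃ j, B j := by
    rintro ω ⟨v, hv, hω⟩
    by_contra hcon
    simp only [Set.mem_union, Set.mem_iUnion, not_or, not_exists] at hcon
    obtain ⟨h0, hj⟩ := hcon
    have h0' : ∑ l, ε ω l * π 0 v l < T / 4 := by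
      by_contra! h; exact h0 ⟨v, hv, h⟩
    have hj' : ∀ j, ∑ l, ε ω l * (π (j + 1) v l - π j v l) < w j := by
      intro j; by_contra! h; exact hj j ⟨v, hv, h⟩
    have hsum : ∀ J, ∑ l, ε ω l * π J v l ≤ T / 4 + T / 6 * (1 - (3 / 4) ^ J) := by
      intro J
      induction J with
      | zero => simpa using h0'.le
      | succ J ih =>
        have h1 := hj' J
        simp only [mul_sub, Finset.sum_sub_distrib] at h1
        have h2 : T / 4 + T / 6 * (1 - (3 / 4) ^ (J + 1))
            = T / 4 + T / 6 * (1 - (3 / 4) ^ J) + w J := by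
          simp only [w]; ring
        rw [h2]; linarith
    -- For fixed `ω` the remainder is deterministic: Cauchy–Schwarz makes it small at a depth `J`
    -- that may depend on `ω`.
    obtain ⟨J, hJ⟩ : ∃ J : ℕ, (∑ l, ε ω l ^ 2) * T / (T / 12) ^ 2 < 2 ^ J :=
      pow_unbounded_of_one_lt _ one_lt_two
    have hrest : ∑ l, ε ω l * (v l - π J v l) < T / 12 := by
      refine (abs_lt.1 (abs_lt_of_sq_lt_sq ?_ (by positivity))).2
      refine (Finset.sum_mul_sq_le_sq_mul_sq _ _ _).trans_lt ?_
      refine (mul_le_mul_of_nonneg_left (hfar J v hv)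
        (Finset.sum_nonneg fun l _ => sq_nonneg _)).trans_lt ?_
      rw [div_lt_iff₀ (by positivity)] at hJ
      rw [← mul_div_assoc, div_lt_iff₀ (by positivity)]
      linarith
    simp only [mul_sub, Finset.sum_sub_distrib] at hrest
    have h3 := hsum J
    have h4 : (0 : ℝ) < (3 / 4) ^ J := by positivity
    nlinarith
  have hB₀ : P B₀ ≤ ENNReal.ofReal (Real.exp (-a)) := by
    rcases V.eq_empty_or_nonempty with hVe | ⟨v₀, hv₀⟩
    · simp [B₀, hVe]
    have hsub : B₀ ⊆ {ω | T / 4 ≤ ∑ l, ε ω l * π 0 v₀ l} := by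
      rintro ω ⟨v, hv, hω⟩
      have : π 0 v = π 0 v₀ := hπ 0 _ _ (by
        have h1 := hlt 0 v hv; have h2 := hlt 0 v₀ hv₀; omega)
      rwa [this] at hω
    refine (measure_mono hsub).trans ((htail _ (2 * T) _ (by positivity)
      (hshell _ (hmem 0 v₀ hv₀)).2.le).trans ?_)
    refine ENNReal.ofReal_le_ofReal (Real.exp_le_exp.2 ?_)
    have : 2 * N * (T / 4) ^ 2 / (2 * T) = 18 * a := by rw [ha]; field_simp; ring
    rw [this]; linarith
  have hB : ∀ j, P (B j) ≤ ENNReal.ofReal (2 * Real.exp (-a) * (1 / 2) ^ j) := by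
    intro j
    have hcov : B j ⊆ ⋃ i ∈ Finset.range (2 ^ (j + 1)),
        {ω | ∃ v ∈ V, cell (j + 1) v = i ∧ w j ≤ ∑ l, ε ω l * (π (j + 1) v l - π j v l)} := by
      rintro ω ⟨v, hv, hω⟩
      simp only [Set.mem_iUnion]
      exact ⟨cell (j + 1) v, Finset.mem_range.2 (hlt _ v hv), v, hv, rfl, hω⟩
    have hone : ∀ i ∈ Finset.range (2 ^ (j + 1)),
        P {ω | ∃ v ∈ V, cell (j + 1) v = i ∧ w j ≤ ∑ l, ε ω l * (π (j + 1) v l - π j v l)}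
          ≤ ENNReal.ofReal (Real.exp (-(a * (9 / 8) ^ j))) := by
      intro i _
      by_cases hi : ∃ v₀ ∈ V, cell (j + 1) v₀ = i
      · obtain ⟨v₀, hv₀, rfl⟩ := hi
        have hsub : {ω | ∃ v ∈ V, cell (j + 1) v = cell (j + 1) v₀ ∧
              w j ≤ ∑ l, ε ω l * (π (j + 1) v l - π j v l)}
            ⊆ {ω | w j ≤ ∑ l, ε ω l * (π (j + 1) v₀ l - π j v₀ l)} := by
          rintro ω ⟨v, hv, hc, hω⟩
          rwa [hπ (j + 1) v v₀ hc, hπ j v v₀ (hnest j v hv v₀ hv₀ hc)] at hω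
        refine (measure_mono hsub).trans ((htail (fun l => π (j + 1) v₀ l - π j v₀ l) _ _ (hw j)
          (hlink j v₀ hv₀)).trans_eq ?_)
        have h98 : (9 / 8 : ℝ) ^ j = ((3 / 4) ^ j) ^ 2 * 2 ^ j := by
          rw [← pow_mul, mul_comm j 2, pow_mul, ← mul_pow]; norm_num
        congr 3
        rw [ha, h98]
        simp only [w]
        field_simp
        ring
      · have : {ω | ∃ v ∈ V, cell (j + 1) v = i ∧
            w j ≤ ∑ l, ε ω l * (π (j + 1) v l - π j v l)} = ∅ := by
          ext ω
          simp only [Set.mem_ofPred_eq, Set.mem_empty_iff_false, iff_false]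
          rintro ⟨v, hv, hc, -⟩
          exact hi ⟨v, hv, hc⟩
        rw [this]; simp
    refine (measure_mono hcov).trans ((measure_biUnion_finset_le _ _).trans
      ((Finset.sum_le_sum hone).trans ?_))
    rw [Finset.sum_const, Finset.card_range, nsmul_eq_mul, ← ENNReal.ofReal_natCast,
      ← ENNReal.ofReal_mul (Nat.cast_nonneg _)]
    refine ENNReal.ofReal_le_ofReal ?_
    -- With `a ≥ 16` this gives `a (9/8) ^ j ≥ a + 2j`, and `exp (-2j) ≤ 4 ^ (-j)` outweighs the `2
    -- ^ (j + 1)` cells.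
    have hbern : 1 + (j : ℝ) * (1 / 8) ≤ (9 / 8) ^ j := by
      have := one_add_mul_le_pow (show (-2 : ℝ) ≤ 1 / 8 by norm_num) j
      norm_num at this ⊢; linarith
    have hexp : Real.exp (-(a * (9 / 8) ^ j)) ≤ Real.exp (-a) * (1 / 4) ^ j := by
      have h4 : Real.exp (-2) ≤ 1 / 4 := by
        rw [Real.exp_neg, inv_le_comm₀ (Real.exp_pos _) (by norm_num)]
        have h1 : (2 : ℝ) ≤ Real.exp 1 := by linarith [Real.add_one_le_exp (1 : ℝ)]
        have h2 : Real.exp 2 = Real.exp 1 * Real.exp 1 := by rw [← Real.exp_add]; norm_num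
        rw [h2]; norm_num; nlinarith
      calc Real.exp (-(a * (9 / 8) ^ j)) ≤ Real.exp (-a + j * (-2)) := by
            apply Real.exp_le_exp.2
            have : (0 : ℝ) ≤ j := Nat.cast_nonneg j
            nlinarith
        _ = Real.exp (-a) * Real.exp (-2) ^ j := by rw [Real.exp_add, Real.exp_nat_mul]
        _ ≤ _ := by gcongr
    push_cast
    calc (2 : ℝ) ^ (j + 1) * Real.exp (-(a * (9 / 8) ^ j))
        ≤ 2 ^ (j + 1) * (Real.exp (-a) * (1 / 4) ^ j) := by gcongr
      _ = 2 * Real.exp (-a) * (2 * (1 / 4)) ^ j := by rw [mul_pow]; ring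
      _ = _ := by norm_num
  calc P {ω | ∃ v ∈ V, T / 2 ≤ ∑ l, ε ω l * v l} ≤ P (B₀ ∪ ⋃ j, B j) := measure_mono hcover
    _ ≤ P B₀ + P (⋃ j, B j) := measure_union_le _ _
    _ ≤ ENNReal.ofReal (Real.exp (-a)) + ENNReal.ofReal (2 * (2 * Real.exp (-a))) :=
        add_le_add hB₀ (measure_iUnion_le_of_geometric (by positivity) hB)
    _ = _ := by
        rw [← ENNReal.ofReal_add (by positivity) (by positivity)]
        congr 1; ring

/-- The noise is unlikely to beat half the squared norm anywhere on a monotone chain outside the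
ball of squared radius `R`. -/
lemma measure_exists_half_sq_le {Ω κ : Type*} [MeasurableSpace Ω] {P : Measure Ω} [Fintype κ]
    {ε : Ω → κ → ℝ} {N : ℝ}
    (htail : ∀ (v : κ → ℝ) (D x : ℝ), 0 < x → ∑ l, v l ^ 2 ≤ D →
      P {ω | x ≤ ∑ l, ε ω l * v l} ≤ ENNReal.ofReal (Real.exp (-(2 * N * x ^ 2 / D))))
    {V : Set (κ → ℝ)}
    (hV : ∀ u ∈ V, ∀ v ∈ V, ∑ l, (u l - v l) ^ 2 ≤ |∑ l, u l ^ 2 - ∑ l, v l ^ 2|)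
    {R : ℝ} (hR : 0 < R) (hNR : 4608 ≤ N * R) :
    P {ω | ∃ v ∈ V, R ≤ ∑ l, v l ^ 2 ∧ (∑ l, v l ^ 2) / 2 ≤ ∑ l, ε ω l * v l}
      ≤ ENNReal.ofReal (10 * Real.exp (-(N * R / 288))) := by
  let S : ℕ → Set (κ → ℝ) := fun p =>
    {v ∈ V | 2 ^ p * R ≤ ∑ l, v l ^ 2 ∧ ∑ l, v l ^ 2 < 2 * (2 ^ p * R)}
  have hcov : {ω | ∃ v ∈ V, R ≤ ∑ l, v l ^ 2 ∧ (∑ l, v l ^ 2) / 2 ≤ ∑ l, ε ω l * v l}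
      ⊆ ⋃ p, {ω | ∃ v ∈ S p, 2 ^ p * R / 2 ≤ ∑ l, ε ω l * v l} := by
    rintro ω ⟨v, hv, hRv, hω⟩
    obtain ⟨p, hp1, hp2⟩ := exists_nat_pow_near ((one_le_div hR).2 hRv) one_lt_two
    rw [le_div_iff₀ hR] at hp1
    rw [div_lt_iff₀ hR, pow_succ] at hp2
    exact Set.mem_iUnion.2 ⟨p, v, ⟨hv, hp1, by linarith⟩, by linarith⟩
  refine (measure_mono hcov).trans ?_
  have e : 10 * Real.exp (-(N * R / 288)) = 2 * (5 * Real.exp (-(N * R / 288))) := by ring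
  rw [e]
  refine measure_iUnion_le_of_geometric (by positivity) fun p => ?_
  have h1p : (1 : ℝ) ≤ 2 ^ p := one_le_pow₀ one_le_two
  refine (measure_shell_le htail (fun u hu v hv => hV u hu.1 v hv.1) (by positivity)
    (by nlinarith) fun v hv => hv.2).trans (ENNReal.ofReal_le_ofReal ?_)
  have hbern : 1 + (p : ℝ) ≤ 2 ^ p := by
    have := one_add_mul_le_pow (show (-2 : ℝ) ≤ 1 by norm_num) p
    norm_num at this ⊢; linarith
  have h2 : Real.exp (-1) ≤ 1 / 2 := by
    rw [Real.exp_neg, inv_le_comm₀ (Real.exp_pos _) (by norm_num)]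
    linarith [Real.add_one_le_exp (1 : ℝ)]
  calc 5 * Real.exp (-(N * (2 ^ p * R) / 288))
      ≤ 5 * Real.exp (-(N * R / 288) + p * (-1)) := by
        gcongr
        have : (0 : ℝ) ≤ p := Nat.cast_nonneg p
        nlinarith
    _ = 5 * Real.exp (-(N * R / 288)) * Real.exp (-1) ^ p := by
        rw [Real.exp_add, Real.exp_nat_mul]; ring
    _ ≤ _ := by gcongr

/-- Coordinatewise ordered nonnegative vectors: the squared distance is at most the difference of
the squared norms. -/
lemma sum_sq_sub_le_abs {κ : Type*} [Fintype κ] {u v : κ → ℝ} (h0 : ∀ l, 0 ≤ u l)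
    (huv : ∀ l, u l ≤ v l) :
    ∑ l, (u l - v l) ^ 2 ≤ |∑ l, u l ^ 2 - ∑ l, v l ^ 2| := by
  rw [abs_sub_comm]
  refine le_trans ?_ (le_abs_self _)
  rw [← Finset.sum_sub_distrib]
  exact Finset.sum_le_sum fun l _ => by nlinarith [h0 l, huv l]

end VCEst

namespace VCEst

/-! ### The least-squares estimate -/

/-- The basic inequality of least squares. -/
lemma half_sum_sq_le_of_fit {k : ℕ} (hk : 0 < k) {n : Fin k → ℕ} {M : ℝ} {ξ : Fin k → ℝ}
    {h g : ℝ} (hfit : IsLeastSquaresFit n M ξ h) (hg : g ∈ Set.Icc 0 M) :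
    (∑ l, (Phi h (n l) - Phi g (n l)) ^ 2) / 2
      ≤ ∑ l, (ξ l - Phi g (n l)) * (Phi h (n l) - Phi g (n l)) := by
  have hk' : (0 : ℝ) < k := by exact_mod_cast hk
  have h1 := isMinOn_iff.1 hfit.2 g hg
  simp only [designNorm] at h1
  rw [Real.sqrt_le_sqrt_iff (by positivity), mul_le_mul_iff_right₀ (by positivity)] at h1
  have h2 : ∑ l, (ξ l - Phi h (n l)) ^ 2 = ∑ l, (ξ l - Phi g (n l)) ^ 2
      - 2 * ∑ l, (ξ l - Phi g (n l)) * (Phi h (n l) - Phi g (n l))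
      + ∑ l, (Phi h (n l) - Phi g (n l)) ^ 2 := by
    rw [Finset.mul_sum, ← Finset.sum_sub_distrib, ← Finset.sum_add_distrib]
    exact Finset.sum_congr rfl fun l _ => by ring
  linarith

/-- On each side of `g` the curve `h ↦ Φ_h - Φ_g` is a chain whose squared increments are bounded by
the increments of the squared norm. -/
lemma sum_sq_sub_Phi_le {k : ℕ} {n : Fin k → ℕ} (hn : ∀ l, 0 < n l) {g h h' : ℝ} (hg : 0 ≤ g)
    (hh : 0 ≤ h) (hh' : 0 ≤ h') (hside : g ≤ h ∧ g ≤ h' ∨ h ≤ g ∧ h' ≤ g) :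
    ∑ l, ((Phi h (n l) - Phi g (n l)) - (Phi h' (n l) - Phi g (n l))) ^ 2
      ≤ |∑ l, (Phi h (n l) - Phi g (n l)) ^ 2 - ∑ l, (Phi h' (n l) - Phi g (n l)) ^ 2| := by
  wlog hle : h ≤ h' generalizing h h'
  · rw [abs_sub_comm]
    refine le_of_eq_of_le (Finset.sum_congr rfl fun l _ => ?_)
      (this hh' hh (by tauto) (le_of_not_ge hle))
    ring
  have mono : ∀ {x y : ℝ}, 0 ≤ x → x ≤ y → ∀ l, Phi x (n l) ≤ Phi y (n l) :=
    fun hx hxy l => Phi_monotoneOn (hn l) hx (hx.trans hxy) hxy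
  rcases hside with ⟨h1, -⟩ | ⟨-, h2⟩
  · exact sum_sq_sub_le_abs (fun l => sub_nonneg.2 (mono hg h1 l))
      fun l => sub_le_sub_right (mono hh hle l) _
  · have := sum_sq_sub_le_abs (u := fun l => Phi g (n l) - Phi h' (n l))
      (v := fun l => Phi g (n l) - Phi h (n l)) (fun l => sub_nonneg.2 (mono hh' h2 l))
      fun l => sub_le_sub_left (mono hh hle l) _
    rw [abs_sub_comm]
    refine le_of_eq_of_le (Finset.sum_congr rfl fun l _ => ?_) (this.trans_eq ?_)
    · ring
    · simp only [sub_sq_comm]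

/-- The factor `20` collects `10` from each side of `h*`; the denominator `36864 = 16 c₃` is `128 *
288`, which leaves ample slack. -/
lemma tail_constants {y : ℝ} (hy : 73728 ≤ y) :
    20 * Real.exp (-(y / 288)) ≤ 13 * Real.exp (-(y / 36864)) := by
  have h1 : Real.exp (-(y / 288)) ≤ Real.exp (-(y / 36864)) * Real.exp (-1) := by
    rw [← Real.exp_add]
    exact Real.exp_le_exp.2 (by linarith)
  have h2 : Real.exp (-1) ≤ 1 / 2 := by
    rw [Real.exp_neg, inv_le_comm₀ (Real.exp_pos _) (by norm_num)]
    linarith [Real.add_one_le_exp (1 : ℝ)]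
  nlinarith [Real.exp_pos (-(y / 36864))]

end VCEst

theorem theorem1
    {X : Type*} [MeasurableSpace X]
    -- the class of classifiers, of VC dimension `hstar`, and the training rule
    (F : Set (X → Bool)) (hstar : ℕ) (hvc : vcDim F = (hstar : ℕ∞))
    (fhat : (n : ℕ) → (Fin n ⊕ Fin n → Bool × X) → X → Bool) (hERM : IsERM F fhat)
    -- the bound on the VC dimension
    (M : ℝ) (hM : (hstar : ℝ) ≤ M)
    -- the design points and the number of replications
    (k m : ℕ) (hk : 0 < k) (hm : 0 < m) (n : Fin k → ℕ) (hn : ∀ l, 0 < n l)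
    -- the simulated data, independent with law `ν`
    {Ω : Type*} [MeasurableSpace Ω] (P : Measure Ω) [IsProbabilityMeasure P]
    (ν : Measure (Bool × X)) [IsProbabilityMeasure ν]
    (Z : (l : Fin k) → Fin m → Fin (n l) ⊕ Fin (n l) → Ω → Bool × X)
    (hlaw : ∀ l i j, HasLaw (Z l i j) ν P)
    (hindep : iIndepFun
      (fun q : (Σ l : Fin k, Fin m × (Fin (n l) ⊕ Fin (n l))) => Z q.1 q.2.1 q.2.2) P)
    (hmeas : ∀ l, AEMeasurable (deviation fhat (n l)) (Measure.pi fun _ => ν))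
    -- the regression model: the residuals of the observations around `Φ_{h*}` have mean zero
    (hnoise : ∀ l, ∫ ω, (xiHat fhat (n l) m (fun i j => Z l i j ω) - Phi hstar (n l)) ∂P = 0)
    -- the least-squares estimate
    (hhat : Ω → ℝ)
    (hfit : ∀ᵐ ω ∂P,
      IsLeastSquaresFit n M (fun l => xiHat fhat (n l) m (fun i j => Z l i j ω)) (hhat ω))
    -- the lower Lipschitz-like constants `c(n, M)`
    (c : ℕ → ℝ) (hc0 : ∀ l, 0 ≤ c (n l))
    (hc : ∀ l, ∀ h ∈ Set.Ico 0 M, ∀ h' ∈ Set.Ico 0 M,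
      c (n l) * |h - h'| ≤ |Phi h (n l) - Phi h' (n l)|)
    -- the Lipschitz constants `L(n)`, away from `h = 0`, where `Φ_h(n)` has infinite slope in `h`,
    -- and up to `h = 2 n`, where it jumps
    (L : ℕ → ℝ) (h₀ : ℝ) (hh₀ : 0 < h₀)
    (hL : ∀ l, ∀ h ∈ Set.Icc h₀ (min M (2 * n l)), ∀ h' ∈ Set.Icc h₀ (min M (2 * n l)),
      |Phi h (n l) - Phi h' (n l)| ≤ L (n l) * |h - h'|)
    (δ : ℝ) (hδ : 4 / √(2 * m * k) * max (24 * c1 (meanSq n L)) 29 < δ) :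
    P.real {ω | δ < |hhat ω - hstar|}
      ≤ 13 * Real.exp (-(m * k * meanSq n c * δ ^ 2 / (16 * c3))) := by
  have hm' : (0 : ℝ) < m := by exact_mod_cast hm
  have hk' : (0 : ℝ) < k := by exact_mod_cast hk
  have hδ0 : 0 < δ := by
    refine lt_of_le_of_lt (mul_nonneg (by positivity) ?_) hδ
    exact le_trans (by norm_num) (le_max_right _ _)
  set R : ℝ := k * meanSq n c * δ ^ 2 with hR
  have hexp : (m * k * meanSq n c * δ ^ 2 / (16 * c3) : ℝ) = m * R / 36864 := by
    rw [hR, c3]; ring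
  rw [hexp]
  -- Below `73728 = 2 * 36864` the right-hand side is at least `13 exp (-2) ≥ 1`; above it, `mR ≥
  -- 4608` as chaining requires.
  rcases lt_or_ge ((m : ℝ) * R) 73728 with hsmall | hlarge
  · refine measureReal_le_one.trans ?_
    have h1 : Real.exp (-2) ≤ Real.exp (-(m * R / 36864)) := Real.exp_le_exp.2 (by linarith)
    have h2 : 1 / 13 ≤ Real.exp (-2) := by
      rw [Real.exp_neg, one_div, inv_le_inv₀ (by norm_num) (Real.exp_pos _)]
      have h3 : Real.exp 2 = Real.exp 1 * Real.exp 1 := by rw [← Real.exp_add]; norm_num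
      have h4 : Real.exp 1 ≤ 3 := by linarith [Real.exp_one_lt_d9]
      rw [h3]
      nlinarith [Real.exp_pos 1]
    linarith
  have hR0 : 0 < R := by
    by_contra! h
    nlinarith
  let ξ : Fin k × Fin m → Ω → ℝ := fun a ω => deviation fhat (n a.1) fun j => Z a.1 a.2 j ω
  have hZind : ∀ a : Fin k × Fin m, iIndepFun (fun j => Z a.1 a.2 j) P := fun a =>
    hindep.precomp (g := fun j => (⟨a.1, (a.2, j)⟩ : Σ l : Fin k, Fin m × (Fin (n l) ⊕ Fin (n l))))
      fun j j' h => by simpa using h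
  have hvec : ∀ a : Fin k × Fin m,
      HasLaw (fun ω j => Z a.1 a.2 j ω) (Measure.pi fun _ => ν) P := fun a =>
    iIndepFun.hasLaw_pi (fun j => hlaw a.1 a.2 j) (hZind a)
  have hblocks : iIndepFun
      (fun (a : Fin k × Fin m) ω (j : Fin (n a.1) ⊕ Fin (n a.1)) => Z a.1 a.2 j ω) P := by
    refine iIndepFun_curry (κ := fun a : Fin k × Fin m => Fin (n a.1) ⊕ Fin (n a.1))
      (Y := fun a j => Z a.1 a.2 j) (fun a j => (hlaw a.1 a.2 j).aemeasurable) ?_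
    refine hindep.precomp (g := fun p : Σ a : Fin k × Fin m, Fin (n a.1) ⊕ Fin (n a.1) =>
      (⟨p.1.1, (p.1.2, p.2)⟩ : Σ l : Fin k, Fin m × (Fin (n l) ⊕ Fin (n l)))) ?_
    rintro ⟨⟨l, i⟩, j⟩ ⟨⟨l', i'⟩, j'⟩ h
    simp only [Sigma.mk.injEq] at h
    obtain ⟨rfl, h⟩ := h
    simp only [heq_eq_eq, Prod.mk.injEq] at h
    obtain ⟨rfl, rfl⟩ := h
    rfl
  have hdev : ∀ a : Fin k × Fin m, AEMeasurable (deviation fhat (n a.1))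
      (P.map fun ω j => Z a.1 a.2 j ω) := fun a => by
    rw [(hvec a).map_eq]; exact hmeas a.1
  have hξind : iIndepFun ξ P :=
    hblocks.comp₀ (fun a => deviation fhat (n a.1)) (fun a => (hvec a).aemeasurable) hdev
  have hξmeas : ∀ a, AEMeasurable (ξ a) P := fun a =>
    (hdev a).comp_aemeasurable (hvec a).aemeasurable
  have hξ01 : ∀ a ω, ξ a ω ∈ Set.Icc (0 : ℝ) 1 := fun a ω => deviation_mem_Icc _ _ _
  have hξint : ∀ a, Integrable (ξ a) P := fun a =>
    Integrable.of_mem_Icc 0 1 (hξmeas a) (ae_of_all _ (hξ01 a))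
  -- The regression model identifies `Φ_{h*}` with the mean observation, so `ε` is a centred average
  -- of independent `[0, 1]`-valued variables.
  have hmean : ∀ l, Phi hstar (n l) = 1 / (m : ℝ) * ∑ i, ∫ ω, ξ (l, i) ω ∂P := by
    intro l
    have h := hnoise l
    have hx : Integrable (fun ω => 1 / (m : ℝ) * ∑ i, ξ (l, i) ω) P :=
      (integrable_finsetSum _ fun i _ => hξint (l, i)).const_mul _
    change ∫ ω, (1 / (m : ℝ) * ∑ i, ξ (l, i) ω - Phi hstar (n l)) ∂P = 0 at h
    rw [integral_sub hx (integrable_const _), integral_const_mul,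
      integral_finsetSum _ fun i _ => hξint (l, i)] at h
    simp only [integral_const, probReal_univ, smul_eq_mul, one_mul] at h
    linarith
  let ε : Ω → Fin k → ℝ := fun ω l =>
    xiHat fhat (n l) m (fun i j => Z l i j ω) - Phi hstar (n l)
  have hε : ∀ ω l, ε ω l = 1 / (m : ℝ) * ∑ i, (ξ (l, i) ω - ∫ ω', ξ (l, i) ω' ∂P) := by
    intro ω l
    rw [Finset.sum_sub_distrib, mul_sub, ← hmean l]
    rfl
  have htail : ∀ (v : Fin k → ℝ) (D x : ℝ), 0 < x → ∑ l, v l ^ 2 ≤ D →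
      P {ω | x ≤ ∑ l, ε ω l * v l} ≤ ENNReal.ofReal (Real.exp (-(2 * m * x ^ 2 / D))) := by
    intro v D x hx hv
    simp only [hε]
    exact hoeffding_linear_combination hm hξmeas hξ01 hξind v hx hv
  have hstar0 : (0 : ℝ) ≤ hstar := Nat.cast_nonneg _
  let Δ : ℝ → Fin k → ℝ := fun h l => Phi h (n l) - Phi hstar (n l)
  have hup := measure_exists_half_sq_le htail (V := Δ '' Set.Ici (hstar : ℝ)) (by
    rintro _ ⟨h, hh, rfl⟩ _ ⟨h', hh', rfl⟩
    exact sum_sq_sub_Phi_le hn hstar0 (hstar0.trans hh) (hstar0.trans hh') (.inl ⟨hh, hh'⟩))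
    hR0 (by linarith)
  have hdown := measure_exists_half_sq_le htail (V := Δ '' Set.Icc 0 (hstar : ℝ)) (by
    rintro _ ⟨h, hh, rfl⟩ _ ⟨h', hh', rfl⟩
    exact sum_sq_sub_Phi_le hn hstar0 hh.1 hh'.1 (.inr ⟨hh.2, hh'.2⟩))
    hR0 (by linarith)
  have hsub : {ω | δ < |hhat ω - hstar|} ≤ᵐ[P]
      ({ω | ∃ v ∈ Δ '' Set.Ici (hstar : ℝ), R ≤ ∑ l, v l ^ 2 ∧
          (∑ l, v l ^ 2) / 2 ≤ ∑ l, ε ω l * v l}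
        ∪ {ω | ∃ v ∈ Δ '' Set.Icc 0 (hstar : ℝ), R ≤ ∑ l, v l ^ 2 ∧
          (∑ l, v l ^ 2) / 2 ≤ ∑ l, ε ω l * v l} : Set Ω) := by
    filter_upwards [hfit] with ω hω hdist
    change δ < |hhat ω - hstar| at hdist
    have hbasic := half_sum_sq_le_of_fit hk hω ⟨hstar0, hM⟩
    have hRle : R ≤ ∑ l, Δ (hhat ω) l ^ 2 := by
      have : R = ∑ l, (c (n l) * δ) ^ 2 := by
        simp only [hR, meanSq, mul_pow, ← Finset.sum_mul]
        field_simp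
      rw [this]
      refine Finset.sum_le_sum fun l _ => ?_
      rw [← sq_abs (Δ (hhat ω) l)]
      refine pow_le_pow_left₀ (mul_nonneg (hc0 l) hδ0.le) ?_ 2
      exact (mul_le_mul_of_nonneg_left hdist.le (hc0 l)).trans
        (lower_bound_Icc (hn l) (hc0 l) (hc l) hω.1 ⟨hstar0, hM⟩)
    rcases le_total (hstar : ℝ) (hhat ω) with hle | hle
    · exact Or.inl ⟨_, ⟨hhat ω, hle, rfl⟩, hRle, hbasic⟩
    · exact Or.inr ⟨_, ⟨hhat ω, ⟨hω.1.1, hle⟩, rfl⟩, hRle, hbasic⟩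
  have htotal : P {ω | δ < |hhat ω - hstar|}
      ≤ ENNReal.ofReal (13 * Real.exp (-(m * R / 36864))) := by
    refine (measure_mono_ae hsub).trans ((measure_union_le _ _).trans
      ((add_le_add hup hdown).trans ?_))
    rw [← ENNReal.ofReal_add (by positivity) (by positivity)]
    refine ENNReal.ofReal_le_ofReal ?_
    have := tail_constants hlarge
    linarith
  exact ENNReal.toReal_le_of_le_ofReal (by positivity) htotal
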